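/- Let $L(\mathfrak{sl}_2)=\mathbb{C}[t,t^{-1}]\otimes\mathfrak{sl}_2(\mathbb{C})$ be the $\mathfrak{sl}_2$ loop algebra, with generators $x_k^{+}=t^k\otimes e$, $x_k^{-}=t^k\otimes f$, $h_k=t^k\otimes h$ ($k\in\mathbb{Z}$), so that $[h_j,x_k^{\pm}]=\pm 2x_{j+k}^{\pm}$, $[x_j^{+},x_k^{-}]=h_{j+k}$, $[h_j,h_k]=0$ and $[x_j^{\pm},x_k^{\pm}]=0$. Let $V$ be a complex representation of $L(\mathfrak{sl}_2)$ and let $\Omega\in V$ be a highest weight vector, i.e. $\Omega\neq 0$, $x_k^{+}\Omega=0$ for all $k\in\mathbb{Z}$, and $\Omega$ is an eigenvector of $h_k$ for every $k\in\mathbb{Z}$. Assume that the subrepresentation $V_\Omega\subseteq V$ generated by $\Omega$ is finite-dimensional. Let $r\in\mathbb{Z}_{\ge 0}$ be the eigenvalue of $h_0$ on $\Omega$, let $\lambda_k$ be the eigenvalue on $\Omega$ of $\frac{(x_0^{+})^k}{k!}\,\frac{(x_1^{-})^k}{k!}$ for $0\le k\le r$, and let $$P_\Omega(u)=\sum_{k=0}^{r}\lambda_k(-u)^k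 .$$ Let $a_1,\dots,a_r\in\mathbb{C}$ be the evaluation parameters of $\Omega$ (listed with multiplicity), i.e. $P_\Omega(u)=\prod_{i=1}^{r}(1-a_iu)$. If $a_1,\dots,a_r$ are pairwise distinct, then the representation $V_\Omega$ is irreducible. -/

import Mathlib

open scoped TensorProduct

noncomputable section

namespace Sl2Loop

/-- The `sl₂` loop algebra `ℂ[t, t⁻¹] ⊗ sl₂(ℂ)`. -/
abbrev LoopSl2 : Type :=
  LieAlgebra.loopAlgebra ℂ ℤ (LieAlgebra.SpecialLinear.sl (Fin 2) ℂ)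

/-- The generator `x_k⁺ = t^k ⊗ e`. -/
def xPlus (k : ℤ) : LoopSl2 :=
  AddMonoidAlgebra.single k (1 : ℂ) ⊗ₜ[ℂ]
    LieAlgebra.SpecialLinear.single (0 : Fin 2) 1 (by decide) (1 : ℂ)

/-- The generator `x_k⁻ = t^k ⊗ f`. -/
def xMinus (k : ℤ) : LoopSl2 :=
  AddMonoidAlgebra.single k (1 : ℂ) ⊗ₜ[ℂ]
    LieAlgebra.SpecialLinear.single (1 : Fin 2) 0 (by decide) (1 : ℂ)

/-- The generator `h_k = t^k ⊗ h`. -/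
def hGen (k : ℤ) : LoopSl2 :=
  AddMonoidAlgebra.single k (1 : ℂ) ⊗ₜ[ℂ]
    LieAlgebra.SpecialLinear.singleSubSingle (0 : Fin 2) 1 (1 : ℂ)

theorem lie_xPlus_xMinus (j k : ℤ) : ⁅xPlus j, xMinus k⁆ = hGen (j + k) := by
  simp only [xPlus, xMinus, hGen, LieAlgebra.ExtendScalars.bracket_tmul,
    AddMonoidAlgebra.single_mul_single, mul_one]
  congr 1
  ext a b
  fin_cases a <;> fin_cases b <;>
    simp [Ring.lie_def, Matrix.mul_apply, Matrix.single_apply] <;> norm_num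

theorem lie_hGen_xPlus (j k : ℤ) : ⁅hGen j, xPlus k⁆ = (2 : ℂ) • xPlus (j + k) := by
  simp only [xPlus, hGen, LieAlgebra.ExtendScalars.bracket_tmul,
    AddMonoidAlgebra.single_mul_single, mul_one, ← TensorProduct.tmul_smul]
  congr 1
  ext a b
  fin_cases a <;> fin_cases b <;>
    simp [Ring.lie_def, Matrix.mul_apply, Matrix.single_apply] <;> norm_num

theorem lie_hGen_xMinus (j k : ℤ) : ⁅hGen j, xMinus k⁆ = (-2 : ℂ) • xMinus (j + k) := by
  simp only [xMinus, hGen, LieAlgebra.ExtendScalars.bracket_tmul,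
    AddMonoidAlgebra.single_mul_single, mul_one, ← TensorProduct.tmul_smul]
  congr 1
  ext a b
  fin_cases a <;> fin_cases b <;>
    simp [Ring.lie_def, Matrix.mul_apply, Matrix.single_apply] <;> norm_num

open Classical in
/-- The eigenvalue of the operator `T` on the eigenvector `Ω` (and `0` if `Ω` is not an
eigenvector of `T`). -/
def eigenvalueOn {V : Type*} [AddCommGroup V] [Module ℂ V] (T : Module.End ℂ V) (Ω : V) : ℂ :=
  if h : ∃ c : ℂ, T Ω = c • Ω then h.choose else 0

theorem eigenvalueOn_eq {V : Type*} [AddCommGroup V] [Module ℂ V] {T : Module.End ℂ V} {Ω : V}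
    (hΩ : Ω ≠ 0) {c : ℂ}
    (h : T Ω = c • Ω) : eigenvalueOn T Ω = c := by
  have hex : ∃ c : ℂ, T Ω = c • Ω := ⟨c, h⟩
  rw [eigenvalueOn, dif_pos hex]
  exact smul_left_injective ℂ hΩ (hex.choose_spec.symm.trans h)

section Representation

variable {V : Type*} [AddCommGroup V] [Module ℂ V] [LieRingModule LoopSl2 V]

/-- A highest weight vector: a nonzero vector annihilated by all `x_k⁺` that is an eigenvector of
every `h_k`, `k ∈ ℤ`. -/
structure IsHighestWeightVector (Ω : V) : Prop where
  ne_zero : Ω ≠ 0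
  xPlus_lie : ∀ k : ℤ, ⁅xPlus k, Ω⁆ = 0
  hGen_lie : ∀ k : ℤ, ∃ d : ℂ, ⁅hGen k, Ω⁆ = d • Ω

/-- The representation `V_Ω` generated by `Ω`: the smallest subrepresentation containing `Ω`. -/
abbrev generatedRep (Ω : V) : LieSubmodule ℂ LoopSl2 V :=
  LieSubmodule.lieSpan ℂ LoopSl2 {Ω}

/-- The divided power `X^(n) = X^n / n!` of the operator by which `X` acts on `V`. -/
def dividedPower (V : Type*) [AddCommGroup V] [Module ℂ V] [LieRingModule LoopSl2 V]
    [LieModule ℂ LoopSl2 V] (X : LoopSl2) (n : ℕ) : Module.End ℂ V :=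
  ((n.factorial : ℂ)⁻¹) • (LieModule.toEnd ℂ LoopSl2 V X) ^ n

open Classical in
/-- The natural number `r` with `h_0 Ω = r Ω`. (It exists if `Ω` is a highest weight vector that
generates a finite-dimensional representation; if there is none, the value is `0`.) -/
def weight (Ω : V) : ℕ :=
  if h : ∃ r : ℕ, ⁅hGen 0, Ω⁆ = (r : ℂ) • Ω then h.choose else 0

theorem weight_eq {Ω : V} (hΩ : Ω ≠ 0) {r : ℕ} (h : ⁅hGen 0, Ω⁆ = (r : ℂ) • Ω) :
    weight Ω = r := by
  have hex : ∃ r : ℕ, ⁅hGen 0, Ω⁆ = (r : ℂ) • Ω := ⟨r, h⟩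
  rw [weight, dif_pos hex]
  exact_mod_cast smul_left_injective ℂ hΩ (hex.choose_spec.symm.trans h)

variable [LieModule ℂ LoopSl2 V]

/-- `λ_k`, the eigenvalue on `Ω` of the operator `(x_0⁺)^(k) (x_1⁻)^(k)`. -/
def lam (Ω : V) (k : ℕ) : ℂ :=
  eigenvalueOn (dividedPower V (xPlus 0) k * dividedPower V (xMinus 1) k) Ω

/-- The Drinfeld polynomial `P_Ω(u) = ∑_{k=0}^r λ_k (-u)^k`. -/
def drinfeldPolynomial (Ω : V) : Polynomial ℂ :=
  ∑ k ∈ Finset.range (weight Ω + 1), Polynomial.C (lam Ω k) * (-Polynomial.X) ^ k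

/-- `a_1, …, a_r` are the evaluation parameters of `Ω`, listed with multiplicity:
`P_Ω(u) = ∏_{i=1}^r (1 - a_i u)`. -/
def IsEvaluationParameters (Ω : V) (a : Fin (weight Ω) → ℂ) : Prop :=
  drinfeldPolynomial Ω = ∏ i, (1 - Polynomial.C (a i) * Polynomial.X)

end Representation

end Sl2Loop

end

/-!
Write `N` for the representation generated by `Ω` and `r` for the weight of `Ω`. By `sl₂`-theory
`(x₁⁻)^(r+1) Ω = 0`. Applying `(x₀⁺)^(r)` and Garland's formula gives `(t q ⊗ f) Ω = 0` for a
polynomial `q` which is, up to sign, the reversal `∏ (t - aᵢ)` of the Drinfeld polynomial. As `t` is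
a unit and `N` is cyclic, `∏ (t - aᵢ) ⊗ sl₂` then kills all of `N`.

If the `aᵢ` are distinct, the Chinese remainder theorem provides elements `εᵢ` which modulo
`∏ (t - aᵢ)` are orthogonal idempotents with sum `1`, so the loop algebra acts on `N` through
commuting copies `εᵢ ⊗ sl₂` of `sl₂`. The Casimir operator of each copy commutes with the action, so
it is the scalar by which it acts on `Ω`. This scalar determines the `h`-weight of a vector killed
by `e`, so every vector killed by all `xₖ⁺` has weight `r` and is a multiple of `Ω`. A nonzero
subrepresentation contains such a vector, hence `Ω`.
-/

noncomputable section

namespace Sl2Loop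

open LieAlgebra.SpecialLinear

section Matrices

variable (R : Type*) [CommRing R]

/-- The matrix `e` of `sl₂`. -/
abbrev sl2E : sl (Fin 2) R := single 0 1 (by decide) 1

/-- The matrix `f` of `sl₂`. -/
abbrev sl2F : sl (Fin 2) R := single 1 0 (by decide) 1

/-- The matrix `h` of `sl₂`. -/
abbrev sl2H : sl (Fin 2) R := singleSubSingle 0 1 1

theorem lie_sl2E_sl2F : ⁅sl2E R, sl2F R⁆ = sl2H R := by
  ext i j
  fin_cases i <;> fin_cases j <;> simp [Ring.lie_def]

theorem lie_sl2H_sl2E : ⁅sl2H R, sl2E R⁆ = (2 : R) • sl2E R := by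
  ext i j
  fin_cases i <;> fin_cases j <;>
    simp [Ring.lie_def, Matrix.mul_apply, Matrix.single_apply]
  ring

theorem lie_sl2H_sl2F : ⁅sl2H R, sl2F R⁆ = (-2 : R) • sl2F R := by
  ext i j
  fin_cases i <;> fin_cases j <;>
    simp [Ring.lie_def, Matrix.mul_apply, Matrix.single_apply]
  ring

variable {R}

theorem eq_smul_sl2E_add_smul_sl2F_add_smul_sl2H (X : sl (Fin 2) R) :
    X = X.val 0 1 • sl2E R + X.val 1 0 • sl2F R + X.val 0 0 • sl2H R := by
  have htrace : X.val 0 0 + X.val 1 1 = 0 := by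
    simpa [Matrix.trace, Fin.sum_univ_two] using LinearMap.mem_ker.mp X.2
  ext i j
  fin_cases i <;> fin_cases j <;> simp
  linear_combination htrace

end Matrices

/-- The `sl₂` relations `[e, f] = h`, `[h, e] = 2e`, `[h, f] = -2f` in an associative ring, solved
for reordering products. Unlike `IsSl2Triple`, this allows `h = e = f = 0`, so that it applies to
the operators of any representation. -/
structure Sl2Relations {B : Type*} [Ring B] (h e f : B) : Prop where
  e_mul_f : e * f = f * e + h
  h_mul_e : h * e = e * h + 2 • e
  h_mul_f : h * f = f * h - 2 • f

/-- The Casimir element `h² + 2h + 4fe` of an `sl₂`-triple in an associative ring. -/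
def casimir {B : Type*} [Ring B] (h e f : B) : B :=
  h * h + 2 • h + 4 • (f * e)

namespace Sl2Relations

section Ring

variable {B : Type*} [Ring B] {h e f : B} (t : Sl2Relations h e f)
include t

theorem commute_casimir_e : Commute (casimir h e f) e := by
  unfold Commute SemiconjBy casimir
  linear_combination (norm := noncomm_ring) h * t.h_mul_e + t.h_mul_e * h - 4 * t.e_mul_f * e

theorem commute_casimir_f : Commute (casimir h e f) f := by
  unfold Commute SemiconjBy casimir
  linear_combination (norm := noncomm_ring) h * t.h_mul_f + t.h_mul_f * h + 4 * f * t.e_mul_f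

end Ring

section End

variable {K M : Type*} [Field K] [CharZero K] [AddCommGroup M] [Module K M]
  {H E F : Module.End K M} (t : Sl2Relations H E F) {w : M}
include t

attribute [local instance] LieRing.ofAssociativeRing

omit [CharZero K] in
theorem hasPrimitiveVectorWith (hH : H ≠ 0) (hw : w ≠ 0) (hEw : E w = 0) {μ : K}
    (hHw : H w = μ • w) :
    ∃ t' : IsSl2Triple H E F, t'.HasPrimitiveVectorWith w μ :=
  ⟨{ h_ne_zero := hH
     lie_e_f := by rw [Ring.lie_def, t.e_mul_f, add_sub_cancel_left]
     lie_h_e_nsmul := by rw [Ring.lie_def, t.h_mul_e, add_sub_cancel_left]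
     lie_h_f_nsmul := by rw [Ring.lie_def, t.h_mul_f, sub_sub_cancel_left] }, hw, hHw, hEw⟩

variable [FiniteDimensional K M]

theorem exists_nat_of_apply_eq_smul (hw : w ≠ 0) (hEw : E w = 0) {μ : K} (hHw : H w = μ • w) :
    ∃ n : ℕ, μ = n := by
  by_cases hH : H = 0
  · refine ⟨0, ?_⟩
    rw [hH, LinearMap.zero_apply, eq_comm, smul_eq_zero] at hHw
    simpa using hHw.resolve_right hw
  · obtain ⟨_, P⟩ := t.hasPrimitiveVectorWith hH hw hEw hHw
    exact P.exists_nat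

theorem pow_succ_apply_eq_zero (hw : w ≠ 0) (hEw : E w = 0) {n : ℕ} (hHw : H w = (n : K) • w) :
    (F ^ (n + 1)) w = 0 := by
  by_cases hH : H = 0
  · have hF : F = 0 := by
      have h := t.h_mul_f
      rw [hH, zero_mul, mul_zero, zero_sub, eq_comm, neg_eq_zero, ← ofNat_smul_eq_nsmul K,
        smul_eq_zero] at h
      exact h.resolve_left two_ne_zero
    rw [hF, zero_pow n.succ_ne_zero, LinearMap.zero_apply]
  · obtain ⟨_, P⟩ := t.hasPrimitiveVectorWith hH hw hEw hHw
    exact P.pow_toEnd_f_eq_zero_of_eq_nat rfl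

theorem apply_eq_smul_of_casimir_apply {m : ℕ} (hEw : E w = 0)
    (hC : casimir H E F w = ((m : K) * (m + 2)) • w) : H w = (m : K) • w := by
  set v := H w - (m : K) • w with hv
  have hC' : H (H w) + (2 : K) • H w = ((m : K) * (m + 2)) • w := by
    rw [← hC, ofNat_smul_eq_nsmul]
    simp [casimir, hEw]
  have hEv : E v = 0 := by
    have h := congrArg (· w) t.h_mul_e
    simp only [Module.End.mul_apply, LinearMap.add_apply, LinearMap.smul_apply, hEw, map_zero,
      smul_zero, add_zero] at h
    rw [hv, map_sub, map_smul, hEw, ← h, smul_zero, sub_zero]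
  have hHv : H v = (-((m : K) + 2)) • v := by
    rw [hv, map_sub, map_smul, eq_sub_of_add_eq hC']
    module
  by_contra hne
  obtain ⟨n, hn⟩ := t.exists_nat_of_apply_eq_smul (sub_ne_zero.mpr hne) hEv hHv
  have : ((n + m + 2 : ℕ) : K) = 0 := by push_cast; linear_combination -hn
  exact absurd (Nat.cast_eq_zero.mp this) (by lia)

end End

end Sl2Relations

section DivPow

variable {K B : Type*} [Field K] [Ring B] [Algebra K B]

variable (K) in
/-- The divided power `x ^ n / n!`. -/
def divPow (n : ℕ) (x : B) : B :=
  (n.factorial : K)⁻¹ • x ^ n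

@[simp]
theorem divPow_zero (x : B) : divPow K 0 x = 1 := by simp [divPow]

variable [CharZero K]

theorem smul_divPow_succ (n : ℕ) (x : B) :
    ((n : K) + 1) • divPow K (n + 1) x = x * divPow K n x := by
  have hn : (n : K) + 1 ≠ 0 := Nat.cast_add_one_ne_zero n
  rw [divPow, divPow, mul_smul_comm, ← pow_succ', smul_smul, Nat.factorial_succ]
  push_cast
  rw [mul_inv, mul_inv_cancel_left₀ hn]

theorem mul_divPow_succ {h x y : B} (hx : h * x = x * h + y) (hy : Commute y x) (n : ℕ) :
    h * divPow K (n + 1) x = divPow K (n + 1) x * h + y * divPow K n x := by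
  induction n with
  | zero => simpa [divPow] using hx
  | succ n ih =>
    refine smul_right_injective B (Nat.cast_add_one_ne_zero (R := K) (n + 1)) ?_
    have hyx : x * (y * divPow K n x) = y * (x * divPow K n x) := by
      rw [← mul_assoc, ← hy.eq, mul_assoc]
    calc ((n + 1 : ℕ) + 1 : K) • (h * divPow K (n + 2) x)
        = x * (h * divPow K (n + 1) x) + y * divPow K (n + 1) x := by
          rw [← mul_smul_comm, smul_divPow_succ, ← mul_assoc, hx, add_mul, mul_assoc]
      _ = x * divPow K (n + 1) x * h + ((n : K) + 1 + 1) • (y * divPow K (n + 1) x) := by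
          rw [ih, mul_add, hyx, ← smul_divPow_succ, mul_smul_comm, mul_assoc]
          module
      _ = ((n + 1 : ℕ) + 1 : K) • (divPow K (n + 2) x * h + y * divPow K (n + 1) x) := by
          rw [← smul_divPow_succ, smul_mul_assoc]
          push_cast
          module

theorem divPow_succ_mul {x f h y : B} (hf : x * f = f * x + h) (hh : h * x = x * h + (2 : K) • y)
    (hy : Commute y x) (n : ℕ) :
    divPow K (n + 1) x * f =
      f * divPow K (n + 1) x + (2 : K)⁻¹ • (h * divPow K n x + divPow K n x * h) := by
  induction n with
  | zero =>
    simp only [divPow, zero_add, Nat.factorial, pow_zero, pow_one, Nat.cast_one, inv_one, one_smul,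
      mul_one, one_mul, hf]
    module
  | succ n ih =>
    refine smul_right_injective B (Nat.cast_add_one_ne_zero (R := K) (n + 1)) ?_
    have hxD : x * divPow K n x = ((n : K) + 1) • divPow K (n + 1) x := (smul_divPow_succ n x).symm
    have hhD := mul_divPow_succ (K := K) hh (hy.smul_left 2) n
    calc ((n + 1 : ℕ) + 1 : K) • (divPow K (n + 2) x * f)
        = x * (divPow K (n + 1) x * f) := by
          rw [← smul_mul_assoc, smul_divPow_succ, mul_assoc]
      _ = f * (x * divPow K (n + 1) x) + h * divPow K (n + 1) x
            + (2 : K)⁻¹ • (x * h * divPow K n x + x * divPow K n x * h) := by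
          rw [ih, mul_add, ← mul_assoc, hf, mul_smul_comm, mul_add]
          simp only [add_mul, mul_assoc]
      _ = f * (x * divPow K (n + 1) x) + h * divPow K (n + 1) x
            + (2 : K)⁻¹ • (((n : K) + 1) • (h * divPow K (n + 1) x) - (2 : K) • (y * divPow K n x)
              + ((n : K) + 1) • (divPow K (n + 1) x * h)) := by
          rw [eq_sub_of_add_eq hh.symm, sub_mul, mul_assoc h, hxD, mul_smul_comm, smul_mul_assoc,
            smul_mul_assoc]
      _ = ((n + 1 : ℕ) + 1 : K) • (f * divPow K (n + 2) x
            + (2 : K)⁻¹ • (h * divPow K (n + 1) x + divPow K (n + 1) x * h)) := by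
          have hy' : (2 : K) • (y * divPow K n x) =
              h * divPow K (n + 1) x - divPow K (n + 1) x * h := by
            rw [hhD, smul_mul_assoc, add_sub_cancel_left]
          rw [hy', ← smul_divPow_succ (n + 1), mul_smul_comm]
          push_cast
          module

end DivPow

section CurrentAlgebra

/-- The current algebra `A ⊗ sl₂`; the loop algebra is the case of Laurent polynomials. -/
abbrev CurrentSl2 (K A : Type*) [CommRing K] [CommRing A] [Algebra K A] : Type _ :=
  A ⊗[K] sl (Fin 2) K

variable (K A M : Type*) [CommRing K] [CommRing A] [Algebra K A] [AddCommGroup M] [Module K M]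
  [LieRingModule (CurrentSl2 K A) M] [LieModule K (CurrentSl2 K A) M]

/-- The operator by which `a ⊗ X` acts on `M`, as a linear function of `a`. -/
def currentOp (X : sl (Fin 2) K) : A →ₗ[K] Module.End K M :=
  (LieModule.toEnd K (CurrentSl2 K A) M : CurrentSl2 K A →ₗ[K] Module.End K M) ∘ₗ
    (TensorProduct.mk K A _).flip X

/-- The operator by which `a ⊗ e` acts on `M`, as a linear function of `a`. -/
abbrev eOp : A →ₗ[K] Module.End K M := currentOp K A M (sl2E K)

/-- The operator by which `a ⊗ f` acts on `M`, as a linear function of `a`. -/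
abbrev fOp : A →ₗ[K] Module.End K M := currentOp K A M (sl2F K)

/-- The operator by which `a ⊗ h` acts on `M`, as a linear function of `a`. -/
abbrev hOp : A →ₗ[K] Module.End K M := currentOp K A M (sl2H K)

/-- The ideal of all `a` such that `(a) ⊗ sl₂` acts on `M` by zero. -/
def annIdeal : Ideal A where
  carrier := {a | ∀ c X, currentOp K A M X (c * a) = 0}
  add_mem' ha hb c X := by rw [mul_add, map_add, ha, hb, add_zero]
  zero_mem' c X := by rw [mul_zero, map_zero]
  smul_mem' b a ha c X := by rw [smul_eq_mul, ← mul_assoc, ha]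

variable {K A M}

/-- `Ω` is a highest weight vector on which `a ⊗ h` acts by the scalar `d a`. -/
structure IsHighestWeightWith (Ω : M) (d : A →ₗ[K] K) : Prop where
  ne_zero : Ω ≠ 0
  e_apply : ∀ a, eOp K A M a Ω = 0
  h_apply : ∀ a, hOp K A M a Ω = d a • Ω

local notation "𝐞" => eOp K A M
local notation "𝐟" => fOp K A M
local notation "𝐡" => hOp K A M

theorem currentOp_eq (X : sl (Fin 2) K) (a : A) :
    currentOp K A M X a = X.val 0 1 • 𝐞 a + X.val 1 0 • 𝐟 a + X.val 0 0 • 𝐡 a := by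
  conv_lhs => rw [eq_smul_sl2E_add_smul_sl2F_add_smul_sl2H X]
  simp [currentOp]

theorem currentOp_mul_currentOp (X Y : sl (Fin 2) K) (a b : A) :
    currentOp K A M X a * currentOp K A M Y b =
      currentOp K A M Y b * currentOp K A M X a + currentOp K A M ⁅X, Y⁆ (a * b) := by
  ext v
  have h := leibniz_lie (a ⊗ₜ[K] X : CurrentSl2 K A) (b ⊗ₜ[K] Y : CurrentSl2 K A) v
  rwa [LieAlgebra.ExtendScalars.bracket_tmul, add_comm] at h

theorem commute_currentOp_self (X : sl (Fin 2) K) (a b : A) :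
    Commute (currentOp K A M X a) (currentOp K A M X b) := by
  rw [Commute, SemiconjBy, currentOp_mul_currentOp, lie_self]
  simp [currentOp]

theorem e_mul_f (a b : A) : 𝐞 a * 𝐟 b = 𝐟 b * 𝐞 a + 𝐡 (a * b) := by
  rw [currentOp_mul_currentOp, lie_sl2E_sl2F]

theorem h_mul_e (a b : A) : 𝐡 a * 𝐞 b = 𝐞 b * 𝐡 a + (2 : K) • 𝐞 (a * b) := by
  rw [currentOp_mul_currentOp, lie_sl2H_sl2E]
  simp [currentOp]

theorem h_mul_f (a b : A) : 𝐡 a * 𝐟 b = 𝐟 b * 𝐡 a - (2 : K) • 𝐟 (a * b) := by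
  rw [currentOp_mul_currentOp, lie_sl2H_sl2F]
  simp [currentOp, sub_eq_add_neg]

variable (K) in
theorem e_apply_f_apply (a b : A) (v : M) : 𝐞 a (𝐟 b v) = 𝐟 b (𝐞 a v) + 𝐡 (a * b) v :=
  LinearMap.congr_fun (e_mul_f a b) v

variable (K) in
theorem h_apply_f_apply (a b : A) (v : M) : 𝐡 a (𝐟 b v) = 𝐟 b (𝐡 a v) - (2 : K) • 𝐟 (a * b) v :=
  LinearMap.congr_fun (h_mul_f a b) v

theorem sl2Relations_of_mul_eq_one {a b : A} (hab : a * b = 1) :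
    Sl2Relations (𝐡 1) (𝐞 a) (𝐟 b) where
  e_mul_f := by rw [e_mul_f, hab]
  h_mul_e := by rw [h_mul_e, one_mul, ofNat_smul_eq_nsmul]
  h_mul_f := by rw [h_mul_f, one_mul, ofNat_smul_eq_nsmul]

section Cyclic

variable {Ω : M}

theorem currentOp_mem_of_stable {N : Submodule K M} (he : ∀ a, ∀ v ∈ N, 𝐞 a v ∈ N)
    (hf : ∀ a, ∀ v ∈ N, 𝐟 a v ∈ N) (X : sl (Fin 2) K) (a : A) {v : M} (hv : v ∈ N) :
    currentOp K A M X a v ∈ N := by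
  have hh : 𝐡 a v ∈ N := by
    rw [← one_mul a, eq_sub_of_add_eq' (e_apply_f_apply K 1 a v).symm]
    exact N.sub_mem (he 1 _ (hf a v hv)) (hf a _ (he 1 v hv))
  rw [currentOp_eq]
  exact N.add_mem (N.add_mem (N.smul_mem _ (he a v hv)) (N.smul_mem _ (hf a v hv)))
    (N.smul_mem _ hh)

theorem eq_top_of_stable (hgen : LieSubmodule.lieSpan K (CurrentSl2 K A) {Ω} = ⊤)
    {N : Submodule K M} (hΩ : Ω ∈ N) (he : ∀ a, ∀ v ∈ N, 𝐞 a v ∈ N)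
    (hf : ∀ a, ∀ v ∈ N, 𝐟 a v ∈ N) : N = ⊤ := by
  let N' : LieSubmodule K (CurrentSl2 K A) M :=
    { N with
      lie_mem {x v} hv := by
        change ⁅x, v⁆ ∈ N
        induction x using TensorProduct.induction_on with
        | zero => rw [zero_lie]; exact N.zero_mem
        | tmul a X => exact currentOp_mem_of_stable he hf X a hv
        | add x y hx hy => rw [add_lie]; exact N.add_mem hx hy }
  have hN' : ⊤ ≤ N' := hgen ▸ LieSubmodule.lieSpan_le.mpr (Set.singleton_subset_iff.mpr hΩ)
  exact eq_top_iff.mpr fun v _ => hN' (LieSubmodule.mem_top v)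

theorem apply_eq_smul_of_commute (hgen : LieSubmodule.lieSpan K (CurrentSl2 K A) {Ω} = ⊤)
    {C : Module.End K M} {c : K} (hΩ : C Ω = c • Ω) (he : ∀ a, Commute C (𝐞 a))
    (hf : ∀ a, Commute C (𝐟 a)) (v : M) : C v = c • v := by
  have stable : ∀ {S : Module.End K M}, Commute C S → ∀ v ∈ C.eigenspace c,
      S v ∈ C.eigenspace c := fun {S} hS v hv => by
    rw [Module.End.mem_eigenspace_iff] at hv ⊢
    rw [← Module.End.mul_apply, hS.eq, Module.End.mul_apply, hv, map_smul]
  rw [← Module.End.mem_eigenspace_iff, eq_top_of_stable hgen (Module.End.mem_eigenspace_iff.mpr hΩ)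
    (fun a => stable (he a)) fun a => stable (hf a)]
  exact Submodule.mem_top

end Cyclic

section Annihilator

theorem currentOp_eq_zero_of_mem_annIdeal {a : A} (ha : a ∈ annIdeal K A M)
    (X : sl (Fin 2) K) : currentOp K A M X a = 0 := by
  simpa using ha 1 X

theorem currentOp_eq_of_sub_mem_annIdeal {a b : A} (h : a - b ∈ annIdeal K A M)
    (X : sl (Fin 2) K) : currentOp K A M X a = currentOp K A M X b := by
  rw [← sub_eq_zero, ← map_sub, currentOp_eq_zero_of_mem_annIdeal h]

theorem commute_currentOp_of_mul_mem_annIdeal {a b : A} (h : a * b ∈ annIdeal K A M)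
    (X Y : sl (Fin 2) K) : Commute (currentOp K A M X a) (currentOp K A M Y b) := by
  rw [Commute, SemiconjBy, currentOp_mul_currentOp, currentOp_eq_zero_of_mem_annIdeal h, add_zero]

variable {ε : A}

theorem sl2Relations_of_mul_self_sub_mem (hε : ε * ε - ε ∈ annIdeal K A M) :
    Sl2Relations (𝐡 ε) (𝐞 ε) (𝐟 ε) where
  e_mul_f := by rw [e_mul_f, currentOp_eq_of_sub_mem_annIdeal hε]
  h_mul_e := by rw [h_mul_e, currentOp_eq_of_sub_mem_annIdeal hε, ofNat_smul_eq_nsmul]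
  h_mul_f := by rw [h_mul_f, currentOp_eq_of_sub_mem_annIdeal hε, ofNat_smul_eq_nsmul]

theorem commute_casimir_currentOp_sub (hε : ε * ε - ε ∈ annIdeal K A M) (Y : sl (Fin 2) K)
    (b : A) : Commute (casimir (𝐡 ε) (𝐞 ε) (𝐟 ε)) (currentOp K A M Y (b - ε * b)) := by
  have hmem : ε * (b - ε * b) ∈ annIdeal K A M := by
    convert (annIdeal K A M).mul_mem_left (-b) hε using 1
    ring
  have hX := fun X => commute_currentOp_of_mul_mem_annIdeal hmem X Y
  exact (((hX _).mul_left (hX _)).add_left ((hX _).smul_left 2)).add_left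
    (((hX _).mul_left (hX _)).smul_left 4)

theorem commute_casimir_currentOp {c : K} {b : A} (hε : ε * ε - ε ∈ annIdeal K A M)
    (hb : ε * b - c • ε ∈ annIdeal K A M) {Y : sl (Fin 2) K}
    (hY : Commute (casimir (𝐡 ε) (𝐞 ε) (𝐟 ε)) (currentOp K A M Y ε)) :
    Commute (casimir (𝐡 ε) (𝐞 ε) (𝐟 ε)) (currentOp K A M Y b) := by
  have hdecomp : currentOp K A M Y b = c • currentOp K A M Y ε + currentOp K A M Y (b - ε * b) := by
    rw [← map_smul, ← currentOp_eq_of_sub_mem_annIdeal hb, ← map_add, add_sub_cancel]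
  rw [hdecomp]
  exact (hY.smul_right c).add_right (commute_casimir_currentOp_sub hε Y b)

end Annihilator

end CurrentAlgebra

section HighestWeight

variable {K A M : Type*} [Field K] [CommRing A] [Algebra K A] [AddCommGroup M]
  [Module K M] [LieRingModule (CurrentSl2 K A) M] [LieModule K (CurrentSl2 K A) M]
  {Ω : M} {d : A →ₗ[K] K}

local notation "𝐞" => eOp K A M
local notation "𝐟" => fOp K A M
local notation "𝐡" => hOp K A M

theorem IsHighestWeightWith.mem_annIdeal [NeZero (2 : K)] (hΩ : IsHighestWeightWith Ω d)
    (hgen : LieSubmodule.lieSpan K (CurrentSl2 K A) {Ω} = ⊤) {a : A} (ha : 𝐟 a Ω = 0) :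
    a ∈ annIdeal K A M := by
  have hf : ∀ c, 𝐟 (c * a) Ω = 0 := fun c => by
    have h := h_apply_f_apply K c a Ω
    rw [ha, hΩ.h_apply, map_smul, ha, map_zero, smul_zero, zero_sub, eq_comm, neg_eq_zero] at h
    exact (smul_eq_zero.mp h).resolve_left two_ne_zero
  have hh : ∀ c, 𝐡 (c * a) Ω = 0 := fun c => by
    have h := e_apply_f_apply K 1 (c * a) Ω
    rwa [hf, hΩ.e_apply, map_zero, map_zero, zero_add, one_mul, eq_comm] at h
  let N : Submodule K M := ⨅ (c : A) (X : sl (Fin 2) K), LinearMap.ker (currentOp K A M X (c * a))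
  have mem_N : ∀ v, v ∈ N ↔ ∀ c X, currentOp K A M X (c * a) v = 0 := fun v => by
    simp [N, Submodule.mem_iInf]
  have stable : ∀ Y b, ∀ v ∈ N, currentOp K A M Y b v ∈ N := fun Y b v hv => by
    rw [mem_N] at hv ⊢
    intro c X
    have h := LinearMap.congr_fun (currentOp_mul_currentOp (K := K) (M := M) X Y (c * a) b) v
    simp only [Module.End.mul_apply, LinearMap.add_apply] at h
    rw [h, hv, map_zero, zero_add, mul_right_comm, hv]
  have hΩN : Ω ∈ N := (mem_N Ω).mpr fun c X => by
    rw [currentOp_eq]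
    simp [hf, hh, hΩ.e_apply]
  intro c X
  ext v
  have hv : v ∈ N := eq_top_of_stable hgen hΩN (stable _) (stable _) ▸ Submodule.mem_top
  exact (mem_N v).mp hv c X

variable [CharZero K] [FiniteDimensional K M] {ε : A}

theorem IsHighestWeightWith.h_apply_of_e_apply_eq_zero (hΩ : IsHighestWeightWith Ω d)
    (hgen : LieSubmodule.lieSpan K (CurrentSl2 K A) {Ω} = ⊤) {χ : A → K}
    (hε : ε * ε - ε ∈ annIdeal K A M) (hχ : ∀ b, ε * b - χ b • ε ∈ annIdeal K A M)
    {w : M} (hw : 𝐞 ε w = 0) : 𝐡 ε w = d ε • w := by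
  have t := sl2Relations_of_mul_self_sub_mem hε
  obtain ⟨m, hm⟩ := t.exists_nat_of_apply_eq_smul hΩ.ne_zero (hΩ.e_apply ε) (hΩ.h_apply ε)
  have hCΩ : casimir (𝐡 ε) (𝐞 ε) (𝐟 ε) Ω = ((m : K) * (m + 2)) • Ω := by
    rw [casimir, ← ofNat_smul_eq_nsmul K, ← ofNat_smul_eq_nsmul K]
    simp only [LinearMap.add_apply, LinearMap.smul_apply, Module.End.mul_apply, hΩ.e_apply,
      hΩ.h_apply, map_smul, map_zero, hm]
    module
  rw [hm]
  refine t.apply_eq_smul_of_casimir_apply hw (apply_eq_smul_of_commute hgen hCΩ (fun b => ?_)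
    (fun b => ?_) w)
  · exact commute_casimir_currentOp hε (hχ b) t.commute_casimir_e
  · exact commute_casimir_currentOp hε (hχ b) t.commute_casimir_f

end HighestWeight

section GarlandPoly

variable {K A : Type*} [Field K] [CommRing A] [Algebra K A] (x : A) (d : A →ₗ[K] K)

/-- The elements `P_k` of Garland's formula `e(1)^(k) f(x)^(k+1) Ω = f(x P_k) Ω`, for a highest
weight vector `Ω` with weight `d`. -/
def garlandPoly : ℕ → A
  | 0 => 1
  | k + 1 => algebraMap K A (((k : K) + 1)⁻¹ * d (x * garlandPoly k)) - x * garlandPoly k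

/-- The scalars `c_k` of Garland's formula `e(1)^(k) f(x)^(k) Ω = c_k Ω`, for a highest weight
vector `Ω` with weight `d`. -/
def garlandCoeff : ℕ → K
  | 0 => 1
  | k + 1 => ((k : K) + 1)⁻¹ * d (x * garlandPoly x d k)

/-- The elements `W_k(q)` for which `e(1)^(k) f(xq) f(x)^(k) Ω = f(x W_k(q)) Ω`, for a highest
weight vector `Ω` with weight `d`; they generalize Garland's formula so that it can be proved by
induction on `k`. -/
def garlandShift : ℕ → A → A
  | 0, q => q
  | k + 1, q =>
    q * garlandPoly x d (k + 1) + d (x * q) • garlandPoly x d k - garlandShift k (x * q)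

theorem garlandPoly_succ (k : ℕ) :
    garlandPoly x d (k + 1) = algebraMap K A (garlandCoeff x d (k + 1)) - x * garlandPoly x d k :=
  rfl

theorem garlandShift_succ_add (k : ℕ) (q : A) :
    garlandShift x d (k + 1) q + x * garlandShift x d k q =
      q * garlandPoly x d (k + 1) + algebraMap K A (d (x * (q * garlandPoly x d k))) := by
  induction k generalizing q with
  | zero =>
    simp only [garlandShift, garlandPoly, mul_one, Algebra.algebraMap_eq_smul_one]
    ring
  | succ k ih =>
    have hd : d (x * (q * garlandPoly x d (k + 1))) =
        garlandCoeff x d (k + 1) * d (x * q) - d (x * (x * q * garlandPoly x d k)) := by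
      rw [← smul_eq_mul (garlandCoeff x d (k + 1)), ← map_smul, ← map_sub,
        garlandPoly_succ, Algebra.smul_def]
      congr 1
      ring
    have hW : ∀ n, garlandShift x d (n + 1) q = q * garlandPoly x d (n + 1) +
        d (x * q) • garlandPoly x d n - garlandShift x d n (x * q) := fun _ => rfl
    rw [hd, hW (k + 1), hW k, map_sub, map_mul (algebraMap K A)]
    simp only [Algebra.smul_def]
    linear_combination -ih (x * q) + algebraMap K A (d (x * q)) * garlandPoly_succ x d k

theorem garlandShift_one [CharZero K] (k : ℕ) :
    garlandShift x d k 1 = ((k : K) + 1) • garlandPoly x d k := by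
  induction k with
  | zero => simp [garlandShift, garlandPoly]
  | succ k ih =>
    have hc : d (x * garlandPoly x d k) = ((k : K) + 1) * garlandCoeff x d (k + 1) :=
      (mul_inv_cancel_left₀ (Nat.cast_add_one_ne_zero k) _).symm
    have h := garlandShift_succ_add x d k 1
    rw [ih, one_mul, one_mul, hc] at h
    simp only [Algebra.smul_def, map_mul, map_add, map_one, map_natCast] at h ⊢
    push_cast
    linear_combination h - (k + 1 : A) * garlandPoly_succ x d k

theorem garlandPoly_eq_of_mul_eq_one {y : A} (hxy : x * y = 1) (k : ℕ) :
    garlandPoly x d k =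
      (-x) ^ k * ∑ i ∈ Finset.range (k + 1), algebraMap K A (garlandCoeff x d i) * (-y) ^ i := by
  induction k with
  | zero => simp [garlandPoly, garlandCoeff]
  | succ k ih =>
    have hpow : (-x) ^ (k + 1) * (-y) ^ (k + 1) = 1 := by rw [← mul_pow, neg_mul_neg, hxy, one_pow]
    rw [Finset.sum_range_succ, mul_add, pow_succ' (-x) k, mul_assoc, ← ih, ← pow_succ',
      mul_left_comm, hpow, garlandPoly_succ]
    ring

end GarlandPoly

section Garland

variable {K A M : Type*} [Field K] [CharZero K] [CommRing A] [Algebra K A] [AddCommGroup M]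
  [Module K M] [LieRingModule (CurrentSl2 K A) M] [LieModule K (CurrentSl2 K A) M]
  {Ω : M} {d : A →ₗ[K] K} {x : A} {k : ℕ}

local notation "𝐞" => eOp K A M
local notation "𝐟" => fOp K A M
local notation "𝐡" => hOp K A M

theorem divPow_e_succ_mul_f (a : A) (n : ℕ) :
    divPow K (n + 1) (𝐞 1) * 𝐟 a = 𝐟 a * divPow K (n + 1) (𝐞 1) +
      (2 : K)⁻¹ • (𝐡 a * divPow K n (𝐞 1) + divPow K n (𝐞 1) * 𝐡 a) :=
  divPow_succ_mul (by rw [e_mul_f, one_mul]) (by rw [h_mul_e, mul_one])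
    (commute_currentOp_self _ a 1) n

theorem h_mul_divPow_f_succ (a : A) (n : ℕ) :
    𝐡 a * divPow K (n + 1) (𝐟 x) =
      divPow K (n + 1) (𝐟 x) * 𝐡 a - (2 : K) • (𝐟 (a * x) * divPow K n (𝐟 x)) := by
  rw [mul_divPow_succ (y := -((2 : K) • 𝐟 (a * x))) (by rw [h_mul_f, sub_eq_add_neg])
    ((commute_currentOp_self _ (a * x) x).smul_left 2).neg_left, neg_mul, smul_mul_assoc,
    sub_eq_add_neg]

namespace IsHighestWeightWith

theorem garland_of_shift
    (hshift : divPow K k (𝐞 1) (𝐟 x (divPow K k (𝐟 x) Ω)) = 𝐟 (x * garlandShift x d k 1) Ω) :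
    divPow K k (𝐞 1) (divPow K (k + 1) (𝐟 x) Ω) = 𝐟 (x * garlandPoly x d k) Ω := by
  refine smul_right_injective M (Nat.cast_add_one_ne_zero (R := K) k) ?_
  simp only
  rw [← map_smul, ← LinearMap.smul_apply, smul_divPow_succ, Module.End.mul_apply, hshift,
    garlandShift_one, mul_smul_comm, map_smul, LinearMap.smul_apply]

variable (hΩ : IsHighestWeightWith Ω d)
include hΩ

theorem garland_diag_succ
    (hB : divPow K k (𝐞 1) (divPow K (k + 1) (𝐟 x) Ω) = 𝐟 (x * garlandPoly x d k) Ω) :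
    divPow K (k + 1) (𝐞 1) (divPow K (k + 1) (𝐟 x) Ω) = garlandCoeff x d (k + 1) • Ω := by
  have hk : (k : K) + 1 ≠ 0 := Nat.cast_add_one_ne_zero k
  refine smul_right_injective M hk ?_
  simp only
  rw [← LinearMap.smul_apply, smul_divPow_succ, Module.End.mul_apply, hB, e_apply_f_apply,
    hΩ.e_apply, map_zero, zero_add, one_mul, hΩ.h_apply, smul_smul, garlandCoeff,
    mul_inv_cancel_left₀ hk]

theorem garland_shift (q : A) :
    divPow K k (𝐞 1) (𝐟 (x * q) (divPow K k (𝐟 x) Ω)) = 𝐟 (x * garlandShift x d k q) Ω := by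
  induction k generalizing q with
  | zero => simp [garlandShift]
  | succ k ih =>
    have hB := garland_of_shift (by rw [← ih, mul_one])
    have he := LinearMap.congr_fun (divPow_e_succ_mul_f (K := K) (M := M) (x * q) k)
      (divPow K (k + 1) (𝐟 x) Ω)
    have hh := LinearMap.congr_fun (h_mul_divPow_f_succ (K := K) (x := x) (x * q) k) Ω
    have hhf := h_apply_f_apply K (x * q) (x * garlandPoly x d k) Ω
    simp only [Module.End.mul_apply, LinearMap.add_apply, LinearMap.smul_apply,
      LinearMap.sub_apply, hΩ.h_apply, map_smul] at he hh hhf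
    have hcomm : x * q * x = x * (x * q) := by ring
    have hcomm' : x * q * (x * garlandPoly x d k) = x * (q * (x * garlandPoly x d k)) := by ring
    rw [he, hΩ.garland_diag_succ hB, hB, hh, hhf, map_sub, map_smul (divPow K k (𝐞 1)) (d (x * q)),
      map_smul (divPow K k (𝐞 1)) (2 : K), hB, hcomm, ih, hcomm', garlandShift, garlandPoly_succ]
    simp only [mul_sub, mul_add, map_sub, map_add, map_smul, mul_smul_comm, LinearMap.sub_apply,
      LinearMap.add_apply, LinearMap.smul_apply, Algebra.algebraMap_eq_smul_one, mul_one]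
    module

theorem garland (k : ℕ) :
    divPow K k (𝐞 1) (divPow K (k + 1) (𝐟 x) Ω) = 𝐟 (x * garlandPoly x d k) Ω :=
  garland_of_shift (by rw [← hΩ.garland_shift, mul_one])

theorem garland_diag (k : ℕ) :
    divPow K k (𝐞 1) (divPow K k (𝐟 x) Ω) = garlandCoeff x d k • Ω := by
  cases k with
  | zero => simp [garlandCoeff]
  | succ k => exact hΩ.garland_diag_succ (hΩ.garland k)

end IsHighestWeightWith

end Garland

section Cyclic

variable {K A M : Type*} [Field K] [CommRing A] [Algebra K A] [AddCommGroup M]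
  [Module K M] [LieRingModule (CurrentSl2 K A) M] [LieModule K (CurrentSl2 K A) M]
  {Ω : M} {d : A →ₗ[K] K}

local notation "𝐞" => eOp K A M
local notation "𝐟" => fOp K A M
local notation "𝐡" => hOp K A M

variable (K A) in
/-- The subspace spanned by the vectors `f(a₁) ⋯ f(aₙ) Ω`. If `Ω` is a highest weight vector, it
is a weight space for `1 ⊗ h`, and these subspaces grade the representation generated by `Ω`. -/
def lowerPiece (Ω : M) : ℕ → Submodule K M
  | 0 => Submodule.span K {Ω}
  | n + 1 => ⨆ a, (lowerPiece Ω n).map (𝐟 a)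

theorem f_mem_lowerPiece (a : A) {n : ℕ} {v : M} (hv : v ∈ lowerPiece K A Ω n) :
    𝐟 a v ∈ lowerPiece K A Ω (n + 1) :=
  le_iSup (fun a => (lowerPiece K A Ω n).map (𝐟 a)) a (Submodule.mem_map_of_mem hv)

theorem lowerPiece_succ_le {n : ℕ} {N : Submodule K M}
    (h : ∀ a, ∀ v ∈ lowerPiece K A Ω n, 𝐟 a v ∈ N) : lowerPiece K A Ω (n + 1) ≤ N :=
  iSup_le fun a => Submodule.map_le_iff_le_comap.mpr (h a)

namespace IsHighestWeightWith

variable (hΩ : IsHighestWeightWith Ω d)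
include hΩ

theorem h_mem_lowerPiece (a : A) {n : ℕ} {v : M} (hv : v ∈ lowerPiece K A Ω n) :
    𝐡 a v ∈ lowerPiece K A Ω n := by
  induction n generalizing a v with
  | zero =>
    obtain ⟨c, rfl⟩ := Submodule.mem_span_singleton.mp hv
    rw [map_smul, hΩ.h_apply]
    exact Submodule.smul_mem _ _ (Submodule.smul_mem _ _ (Submodule.mem_span_singleton_self Ω))
  | succ n ih =>
    refine lowerPiece_succ_le (N := (lowerPiece K A Ω (n + 1)).comap (𝐡 a)) (fun b w hw => ?_) hv
    rw [Submodule.mem_comap, h_apply_f_apply]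
    exact Submodule.sub_mem _ (f_mem_lowerPiece b (ih a hw))
      (Submodule.smul_mem _ _ (f_mem_lowerPiece _ hw))

theorem e_apply_eq_zero_of_mem_lowerPiece_zero (a : A) {v : M} (hv : v ∈ lowerPiece K A Ω 0) :
    𝐞 a v = 0 := by
  obtain ⟨c, rfl⟩ := Submodule.mem_span_singleton.mp hv
  rw [map_smul, hΩ.e_apply, smul_zero]

theorem e_mem_lowerPiece (a : A) {n : ℕ} {v : M} (hv : v ∈ lowerPiece K A Ω (n + 1)) :
    𝐞 a v ∈ lowerPiece K A Ω n := by
  induction n generalizing a v with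
  | zero =>
    refine lowerPiece_succ_le (N := (lowerPiece K A Ω 0).comap (𝐞 a)) (fun b w hw => ?_) hv
    rw [Submodule.mem_comap, e_apply_f_apply, hΩ.e_apply_eq_zero_of_mem_lowerPiece_zero a hw,
      map_zero, zero_add]
    exact hΩ.h_mem_lowerPiece _ hw
  | succ n ih =>
    refine lowerPiece_succ_le (N := (lowerPiece K A Ω (n + 1)).comap (𝐞 a)) (fun b w hw => ?_) hv
    rw [Submodule.mem_comap, e_apply_f_apply]
    exact Submodule.add_mem _ (f_mem_lowerPiece b (ih a hw)) (hΩ.h_mem_lowerPiece _ hw)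

theorem lowerPiece_le_eigenspace (n : ℕ) :
    lowerPiece K A Ω n ≤ (𝐡 1).eigenspace (d 1 - 2 * n) := by
  induction n with
  | zero =>
    rw [lowerPiece, Submodule.span_singleton_le_iff_mem, Module.End.mem_eigenspace_iff, hΩ.h_apply,
      Nat.cast_zero, mul_zero, sub_zero]
  | succ n ih =>
    refine lowerPiece_succ_le fun a v hv => ?_
    rw [Module.End.mem_eigenspace_iff, h_apply_f_apply,
      Module.End.mem_eigenspace_iff.mp (ih hv), one_mul, map_smul]
    push_cast
    module

variable (hgen : LieSubmodule.lieSpan K (CurrentSl2 K A) {Ω} = ⊤)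
include hgen

theorem iSup_lowerPiece : ⨆ n, lowerPiece K A Ω n = ⊤ := by
  have le_iSup_piece : ∀ n, lowerPiece K A Ω n ≤ ⨆ n, lowerPiece K A Ω n := le_iSup _
  have stable : ∀ S : Module.End K M,
      (∀ n, ∀ v ∈ lowerPiece K A Ω n, S v ∈ ⨆ n, lowerPiece K A Ω n) →
      ∀ v ∈ ⨆ n, lowerPiece K A Ω n, S v ∈ ⨆ n, lowerPiece K A Ω n := fun S hS =>
    iSup_le (a := (⨆ n, lowerPiece K A Ω n).comap S) hS
  refine eq_top_of_stable hgen (le_iSup_piece 0 (Submodule.mem_span_singleton_self Ω))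
    (fun a => stable _ fun n v hv => ?_)
    fun a => stable _ fun n v hv => le_iSup_piece (n + 1) (f_mem_lowerPiece a hv)
  cases n with
  | zero =>
    rw [hΩ.e_apply_eq_zero_of_mem_lowerPiece_zero a hv]
    exact Submodule.zero_mem _
  | succ n => exact le_iSup_piece n (hΩ.e_mem_lowerPiece a hv)

theorem mem_span_of_h_one_apply [CharZero K] {w : M} (hw : 𝐡 1 w = d 1 • w) :
    w ∈ Submodule.span K {Ω} := by
  have htop : lowerPiece K A Ω 0 ⊔ ⨆ n, lowerPiece K A Ω (n + 1) = ⊤ := by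
    rw [sup_iSup_nat_succ, hΩ.iSup_lowerPiece hgen]
  obtain ⟨u, hu, v, hv, rfl⟩ := Submodule.mem_sup.mp (htop ▸ Submodule.mem_top (x := w))
  have hu' : u ∈ (𝐡 1).eigenspace (d 1) := by simpa using hΩ.lowerPiece_le_eigenspace 0 hu
  have hv' : v ∈ (𝐡 1).eigenspace (d 1) := by
    simpa using Submodule.sub_mem _ (Module.End.mem_eigenspace_iff.mpr hw) hu'
  have hlower : ⨆ n, lowerPiece K A Ω (n + 1) ≤ ⨆ μ ≠ d 1, (𝐡 1).eigenspace μ := by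
    refine iSup_le fun n => (hΩ.lowerPiece_le_eigenspace (n + 1)).trans (le_iSup₂_of_le _ ?_ le_rfl)
    rw [Ne, sub_eq_self, mul_eq_zero, not_or]
    exact ⟨two_ne_zero, Nat.cast_ne_zero.mpr n.succ_ne_zero⟩
  rw [Submodule.disjoint_def.mp ((𝐡 1).eigenspaces_iSupIndep (d 1)) v hv' (hlower hv), add_zero]
  exact hu

theorem exists_mem_e_apply_eq_zero {N : LieSubmodule K (CurrentSl2 K A) M} (hN : N ≠ ⊥) :
    ∃ w ∈ N, w ≠ 0 ∧ ∀ a, 𝐞 a w = 0 := by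
  obtain ⟨v, hvN, hv⟩ : ∃ v ∈ N, v ≠ 0 := by
    by_contra! h
    exact hN ((LieSubmodule.eq_bot_iff N).mpr h)
  obtain ⟨n, hn⟩ : ∃ n, v ∈ partialSups (lowerPiece K A Ω) n := by
    rw [← Submodule.mem_iSup_of_directed _ (partialSups _).monotone.directed_le,
      iSup_partialSups_eq, hΩ.iSup_lowerPiece hgen]
    exact Submodule.mem_top
  induction n generalizing v with
  | zero =>
    exact ⟨v, hvN, hv, fun a => hΩ.e_apply_eq_zero_of_mem_lowerPiece_zero a (by simpa using hn)⟩
  | succ n ih =>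
    by_cases h : ∀ a, 𝐞 a v = 0
    · exact ⟨v, hvN, hv, h⟩
    · obtain ⟨a, ha⟩ := not_forall.mp h
      refine ih _ (N.lie_mem hvN) ha ?_
      refine partialSups_le (lowerPiece K A Ω) (n + 1)
        ((partialSups _ n : Submodule K M).comap (𝐞 a)) (fun i hi u hu => ?_) hn
      cases i with
      | zero =>
        rw [Submodule.mem_comap, hΩ.e_apply_eq_zero_of_mem_lowerPiece_zero a hu]
        exact Submodule.zero_mem _
      | succ i =>
        exact le_partialSups_of_le (lowerPiece K A Ω) (Nat.succ_le_succ_iff.mp hi)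
          (hΩ.e_mem_lowerPiece a hu)

theorem isIrreducible_of_forall_e_apply_eq_zero [CharZero K]
    (hprim : ∀ w, (∀ a, 𝐞 a w = 0) → 𝐡 1 w = d 1 • w) :
    LieModule.IsIrreducible K (CurrentSl2 K A) M := by
  have : Nontrivial M := ⟨Ω, 0, hΩ.ne_zero⟩
  refine LieModule.IsIrreducible.mk fun N hN => ?_
  obtain ⟨w, hwN, hw, hew⟩ := hΩ.exists_mem_e_apply_eq_zero hgen hN
  obtain ⟨c, rfl⟩ := Submodule.mem_span_singleton.mp
    (hΩ.mem_span_of_h_one_apply hgen (hprim w hew))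
  have hΩN : Ω ∈ (N : Submodule K M) := (Submodule.smul_mem_iff _ (left_ne_zero_of_smul hw)).mp hwN
  rw [eq_top_iff, ← hgen]
  exact LieSubmodule.lieSpan_le.mpr (Set.singleton_subset_iff.mpr hΩN)

end IsHighestWeightWith

end Cyclic

section Characters

variable {K A ι : Type*} [Field K] [CommRing A] [Algebra K A] [Finite ι] {χ : ι → A →ₐ[K] K}

theorem exists_forall_algHom_apply_eq (hχ : Function.Injective χ) (x : ι → K) :
    ∃ a, ∀ i, χ i a = x i := by
  have hcoprime : Pairwise (Function.onFun IsCoprime fun i => RingHom.ker (χ i)) := by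
    intro i j hij
    have hmax : ∀ i, (RingHom.ker (χ i)).IsMaximal := fun i =>
      RingHom.ker_isMaximal_of_surjective _ fun c => ⟨algebraMap K A c, (χ i).commutes c⟩
    refine Ideal.isCoprime_of_isMaximal fun hker => hχ.ne hij (AlgHom.ext fun a => ?_)
    have ha : a - algebraMap K A (χ i a) ∈ RingHom.ker (χ j) := by
      refine hker.le ?_
      simp [RingHom.mem_ker]
    exact (sub_eq_zero.mp (by simpa [RingHom.mem_ker] using ha)).symm
  obtain ⟨a, ha⟩ := Ideal.exists_forall_sub_mem_ideal hcoprime fun i => algebraMap K A (x i)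
  refine ⟨a, fun i => ?_⟩
  rw [← sub_eq_zero]
  simpa [RingHom.mem_ker] using ha i

variable {M : Type*} [CharZero K] [AddCommGroup M] [Module K M] [LieRingModule (CurrentSl2 K A) M]
  [LieModule K (CurrentSl2 K A) M] [FiniteDimensional K M] {Ω : M} {d : A →ₗ[K] K}

theorem IsHighestWeightWith.isIrreducible_of_iInf_ker_le_annIdeal (hΩ : IsHighestWeightWith Ω d)
    (hgen : LieSubmodule.lieSpan K (CurrentSl2 K A) {Ω} = ⊤) (hχ : Function.Injective χ)
    (hann : ⨅ i, RingHom.ker (χ i) ≤ annIdeal K A M) :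
    LieModule.IsIrreducible K (CurrentSl2 K A) M := by
  classical
  cases nonempty_fintype ι
  have mem_ann : ∀ b, (∀ i, χ i b = 0) → b ∈ annIdeal K A M := fun b hb =>
    hann (Submodule.mem_iInf _ |>.mpr hb)
  choose ε hε using fun i => exists_forall_algHom_apply_eq hχ (Pi.single i (1 : K))
  have hone : hOp K A M 1 = ∑ i, hOp K A M (ε i) := by
    rw [← map_sum]
    refine currentOp_eq_of_sub_mem_annIdeal (mem_ann _ fun j => ?_) _
    rw [map_sub, map_one, map_sum, Finset.sum_congr rfl fun i _ => hε i j,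
      Finset.sum_pi_single, if_pos (Finset.mem_univ j), sub_self]
  have h_one_apply : ∀ w, (∀ i, hOp K A M (ε i) w = d (ε i) • w) →
      hOp K A M 1 w = (∑ i, d (ε i)) • w := fun w hw => by
    rw [hone, LinearMap.sum_apply, Finset.sum_smul, Finset.sum_congr rfl fun i _ => hw i]
  have hd : d 1 = ∑ i, d (ε i) := smul_left_injective K hΩ.ne_zero <| by
    simpa only [hΩ.h_apply] using h_one_apply Ω fun i => hΩ.h_apply (ε i)
  refine hΩ.isIrreducible_of_forall_e_apply_eq_zero hgen fun w hw => ?_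
  rw [hd]
  refine h_one_apply w fun i =>
    hΩ.h_apply_of_e_apply_eq_zero hgen (χ := χ i) (mem_ann _ fun j => ?_)
      (fun b => mem_ann _ fun j => ?_) (hw (ε i))
  all_goals
    rcases eq_or_ne j i with rfl | hji
    · simp [hε]
    · simp [hε, hji]

end Characters

section EvaluationParameters

open Polynomial

variable {K A : Type*} [Field K] [CommRing A] [Algebra K A] {d : A →ₗ[K] K} {x y : A} {r : ℕ}
  {a : Fin r → K}

theorem garlandPoly_eq_prod (hxy : x * y = 1)
    (ha : ∑ k ∈ Finset.range (r + 1), C (garlandCoeff x d k) * (-X) ^ k =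
      ∏ i, (1 - C (a i) * X)) :
    garlandPoly x d r = (-1) ^ r * ∏ i, (x - algebraMap K A (a i)) := by
  have ha' := congrArg (aeval y) ha
  simp only [map_sum, map_prod, map_mul, map_pow, map_neg, map_sub, map_one, aeval_C,
    aeval_X] at ha'
  have hprod : ∀ z : A, z ^ r = ∏ _i : Fin r, z := fun z => by simp
  rw [garlandPoly_eq_of_mul_eq_one x d hxy, ha', hprod, hprod, ← Finset.prod_mul_distrib,
    ← Finset.prod_mul_distrib]
  refine Finset.prod_congr rfl fun i _ => ?_
  linear_combination algebraMap K A (a i) * hxy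

namespace IsHighestWeightWith

variable {M : Type*} [CharZero K] [AddCommGroup M] [Module K M] [LieRingModule (CurrentSl2 K A) M]
  [LieModule K (CurrentSl2 K A) M] [FiniteDimensional K M] {Ω : M}
  (hΩ : IsHighestWeightWith Ω d)
include hΩ

theorem exists_nat_apply_one : ∃ n : ℕ, d 1 = n :=
  (sl2Relations_of_mul_eq_one (mul_one (1 : A))).exists_nat_of_apply_eq_smul hΩ.ne_zero
    (hΩ.e_apply 1) (hΩ.h_apply 1)

theorem f_apply_mul_garlandPoly (hxy : x * y = 1) (hr : d 1 = r) :
    fOp K A M (x * garlandPoly x d r) Ω = 0 := by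
  have hpow := (sl2Relations_of_mul_eq_one (M := M) (mul_comm x y ▸ hxy)).pow_succ_apply_eq_zero
    hΩ.ne_zero (hΩ.e_apply y) (hr ▸ hΩ.h_apply 1)
  have hdiv : divPow K (r + 1) (fOp K A M x) Ω = 0 := by
    rw [divPow, LinearMap.smul_apply, hpow, smul_zero]
  rw [← hΩ.garland, hdiv, map_zero]

theorem prod_sub_algebraMap_mem_annIdeal
    (hgen : LieSubmodule.lieSpan K (CurrentSl2 K A) {Ω} = ⊤) (hxy : x * y = 1) (hr : d 1 = r)
    (ha : ∑ k ∈ Finset.range (r + 1), C (garlandCoeff x d k) * (-X) ^ k =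
      ∏ i, (1 - C (a i) * X)) :
    ∏ i, (x - algebraMap K A (a i)) ∈ annIdeal K A M := by
  have hunit : IsUnit (x * (-1) ^ r) := (IsUnit.of_mul_eq_one y hxy).mul (isUnit_one.neg.pow r)
  rw [← Ideal.unit_mul_mem_iff_mem _ hunit, mul_assoc, ← garlandPoly_eq_prod hxy ha]
  exact hΩ.mem_annIdeal hgen (hΩ.f_apply_mul_garlandPoly hxy hr)

end IsHighestWeightWith

end EvaluationParameters

section Laurent

open Polynomial LaurentPolynomial

variable {K ι : Type*} [Field K] [Fintype ι]

/-- Evaluation of Laurent polynomials at a unit, as an algebra homomorphism. -/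
def laurentEval (u : Kˣ) : K[T;T⁻¹] →ₐ[K] K :=
  { LaurentPolynomial.eval₂ (RingHom.id K) u with
    commutes' := fun c => LaurentPolynomial.eval₂_C _ u c }

theorem laurentEval_toLaurent (u : Kˣ) (p : K[X]) : laurentEval u (toLaurent p) = p.eval ↑u :=
  LaurentPolynomial.eval₂_toLaurent _ u p

theorem laurentEval_T_one (u : Kˣ) : laurentEval u (T 1) = u := by
  rw [← toLaurent_X, laurentEval_toLaurent, eval_X]

theorem laurentEval_injective : Function.Injective (laurentEval (K := K)) := fun u v huv =>
  Units.ext <| by simpa only [laurentEval_T_one] using DFunLike.congr_fun huv (T 1)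

theorem toLaurent_prod_X_sub_C_dvd {a : ι → K} (ha : Function.Injective a) {g : K[T;T⁻¹]}
    (hg : ∀ i (h : a i ≠ 0), laurentEval (Units.mk0 (a i) h) g = 0) :
    toLaurent (∏ i, (X - Polynomial.C (a i))) ∣ g := by
  obtain ⟨n, p, hp⟩ := g.exists_T_pow
  have hdvd : ∏ i, (X - Polynomial.C (a i)) ∣ X * p := by
    refine Finset.prod_dvd_of_coprime (fun i _ j _ hij => pairwise_coprime_X_sub_C ha hij)
      fun i _ => dvd_iff_isRoot.mpr ?_
    rw [IsRoot, eval_mul, eval_X]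
    by_cases h : a i = 0
    · rw [h, zero_mul]
    · rw [← Units.val_mk0 h, ← laurentEval_toLaurent, hp, map_mul, hg i h, zero_mul, mul_zero]
  have h := map_dvd toLaurent hdvd
  rwa [map_mul, hp, toLaurent_X, (isUnit_T 1).dvd_mul_left, (isUnit_T n).dvd_mul_right] at h

theorem IsHighestWeightWith.isIrreducible_of_prod_mem_annIdeal {M : Type*} [CharZero K]
    [AddCommGroup M] [Module K M] [LieRingModule (CurrentSl2 K K[T;T⁻¹]) M]
    [LieModule K (CurrentSl2 K K[T;T⁻¹]) M] [FiniteDimensional K M] {Ω : M}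
    {d : K[T;T⁻¹] →ₗ[K] K} (hΩ : IsHighestWeightWith Ω d)
    (hgen : LieSubmodule.lieSpan K (CurrentSl2 K K[T;T⁻¹]) {Ω} = ⊤) {a : ι → K}
    (ha : Function.Injective a)
    (hann : toLaurent (∏ i, (X - Polynomial.C (a i))) ∈ annIdeal K K[T;T⁻¹] M) :
    LieModule.IsIrreducible K (CurrentSl2 K K[T;T⁻¹]) M := by
  let χ : {i // a i ≠ 0} → K[T;T⁻¹] →ₐ[K] K := fun i => laurentEval (Units.mk0 (a i) i.2)
  have hχ : Function.Injective χ := fun i j hij =>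
    Subtype.ext (ha (Units.mk0_inj _ _ |>.mp (laurentEval_injective hij)))
  refine hΩ.isIrreducible_of_iInf_ker_le_annIdeal hgen hχ fun g hg => ?_
  rw [Submodule.mem_iInf] at hg
  exact Ideal.mem_of_dvd _ (toLaurent_prod_X_sub_C_dvd ha fun i h => hg ⟨i, h⟩) hann

end Laurent

section GeneratedRep

open Polynomial LaurentPolynomial

variable {V : Type*} [AddCommGroup V] [Module ℂ V] [LieRingModule LoopSl2 V] {Ω : V}

theorem IsHighestWeightVector.exists_isHighestWeightWith [LieModule ℂ LoopSl2 V]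
    (hΩ : IsHighestWeightVector Ω) :
    ∃ d : ℂ[T;T⁻¹] →ₗ[ℂ] ℂ, IsHighestWeightWith Ω d := by
  obtain ⟨φ, hφ⟩ := Module.Projective.exists_dual_eq_one ℂ hΩ.ne_zero
  refine ⟨φ ∘ₗ (hOp ℂ ℂ[T;T⁻¹] V).flip Ω, hΩ.ne_zero, fun g => ?_, fun g => ?_⟩
  · induction g using LaurentPolynomial.induction_on' with
    | add p q hp hq => rw [map_add, LinearMap.add_apply, hp, hq, add_zero]
    | C_mul_T n c =>
      rw [← LaurentPolynomial.smul_eq_C_mul, map_smul, LinearMap.smul_apply]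
      exact (congrArg (c • ·) (hΩ.xPlus_lie n)).trans (smul_zero c)
  · induction g using LaurentPolynomial.induction_on' with
    | add p q hp hq => rw [map_add, LinearMap.add_apply, hp, hq, map_add, add_smul]
    | C_mul_T n c =>
      obtain ⟨μ, hμ⟩ : ∃ μ : ℂ, hOp ℂ ℂ[T;T⁻¹] V (T n) Ω = μ • Ω := hΩ.hGen_lie n
      rw [← LaurentPolynomial.smul_eq_C_mul, map_smul, map_smul]
      simp [hμ, hφ, mul_smul]

variable (Ω) in
/-- The vector `Ω` as an element of the representation it generates. -/
def generator : generatedRep Ω :=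
  ⟨Ω, LieSubmodule.subset_lieSpan (Set.mem_singleton Ω)⟩

theorem lieSpan_generator : LieSubmodule.lieSpan ℂ LoopSl2 {generator Ω} = ⊤ := by
  have h : generatedRep Ω ≤
      (LieSubmodule.lieSpan ℂ LoopSl2 {generator Ω}).map (generatedRep Ω).incl :=
    LieSubmodule.lieSpan_le.mpr <| Set.singleton_subset_iff.mpr <|
      LieSubmodule.mem_map_of_mem (LieSubmodule.subset_lieSpan (Set.mem_singleton _))
  refine eq_top_iff.mpr fun x _ => ?_
  obtain ⟨y, hy, hyx⟩ := (LieSubmodule.mem_map _).mp (h x.2)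
  rwa [← Subtype.ext hyx]

variable [LieModule ℂ LoopSl2 V]

theorem IsHighestWeightWith.generator {d : ℂ[T;T⁻¹] →ₗ[ℂ] ℂ} (hΩ : IsHighestWeightWith Ω d) :
    IsHighestWeightWith (M := generatedRep Ω) (generator Ω) d where
  ne_zero h := hΩ.ne_zero (congrArg Subtype.val h)
  e_apply a := Subtype.ext (hΩ.e_apply a)
  h_apply a := Subtype.ext (hΩ.h_apply a)

theorem IsHighestWeightWith.lam_eq {d : ℂ[T;T⁻¹] →ₗ[ℂ] ℂ} (hΩ : IsHighestWeightWith Ω d) (k : ℕ) :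
    lam Ω k = garlandCoeff (T 1) d k :=
  eigenvalueOn_eq hΩ.ne_zero (hΩ.garland_diag (x := T 1) k)

theorem IsHighestWeightWith.apply_one_eq_weight {d : ℂ[T;T⁻¹] →ₗ[ℂ] ℂ}
    [FiniteDimensional ℂ (generatedRep Ω)] (hΩ : IsHighestWeightWith Ω d) : d 1 = weight Ω := by
  obtain ⟨n, hn⟩ := hΩ.generator.exists_nat_apply_one
  have h : ⁅hGen 0, Ω⁆ = (n : ℂ) • Ω := hn ▸ hΩ.h_apply 1
  rw [hn, weight_eq hΩ.ne_zero h]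

theorem IsHighestWeightWith.toLaurent_prod_mem_annIdeal {d : ℂ[T;T⁻¹] →ₗ[ℂ] ℂ}
    [FiniteDimensional ℂ (generatedRep Ω)] (hΩ : IsHighestWeightWith Ω d)
    {a : Fin (weight Ω) → ℂ} (ha : IsEvaluationParameters Ω a) :
    toLaurent (∏ i, (X - Polynomial.C (a i))) ∈ annIdeal ℂ ℂ[T;T⁻¹] (generatedRep Ω) := by
  have h := hΩ.generator.prod_sub_algebraMap_mem_annIdeal lieSpan_generator
    (x := T 1) (y := T (-1)) (by rw [← T_add, add_neg_cancel, T_zero]) hΩ.apply_one_eq_weight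
    (a := a) (by
      simpa only [IsEvaluationParameters, drinfeldPolynomial, hΩ.lam_eq] using ha)
  simpa using h

end GeneratedRep

end Sl2Loop

end

theorem mainTheorem1 {V : Type*} [AddCommGroup V] [Module ℂ V]
    [LieRingModule Sl2Loop.LoopSl2 V] [LieModule ℂ Sl2Loop.LoopSl2 V]
    (Ω : V) (hΩ : Sl2Loop.IsHighestWeightVector Ω)
    (hfin : FiniteDimensional ℂ (Sl2Loop.generatedRep Ω))
    (a : Fin (Sl2Loop.weight Ω) → ℂ) (ha : Sl2Loop.IsEvaluationParameters Ω a)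
    (hdistinct : Function.Injective a) :
    LieModule.IsIrreducible ℂ Sl2Loop.LoopSl2 (Sl2Loop.generatedRep Ω) := by
  obtain ⟨d, hd⟩ := hΩ.exists_isHighestWeightWith
  exact hd.generator.isIrreducible_of_prod_mem_annIdeal Sl2Loop.lieSpan_generator hdistinct
    (hd.toLaurent_prod_mem_annIdeal ha)
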